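/- Let $\mathbb{F}_q$ be a finite field, let $0\le v<j<s$ be integers, and let $S_1,S_2\subseteq\mathbb{F}_q$ with $\#S_1=\#S_2=s$. Let $\mathrm{ev}$ evaluate polynomials in $\mathbb{F}_q[X_1,X_2]$ at the points of $S_1\times S_2$, and for a set $L$ of monomials let $C(L)\subseteq\mathbb{F}_q^{S_1\times S_2}$ be the span of $\{\mathrm{ev}(M): M\in L\}$. Put $$L_1=\{X_1^{a}X_2^{b}: 0\le a,b\le j\},\quad \Box=\{X_1^{a}X_2^{b}: v\le a,b\le j\},\quad L_2=L_1\setminus\Box,$$ $C_1=C(L_1)$, $C_2=C(L_2)$, and $\Diamond=\{M\in L_1: X_1^vX_2^v\preceq M\}$, where $\preceq$ is the lexicographic ordering with $X_2\prec X_1$. For a set $K$ of monomials let $D(K)$ be the number of monomials $X_1^aX_2^b$ with $0\le a,b<s$ that are divisible by some element of $K$. Assume that the scheme is considerate: for every $i=1,\dots,\#\Box$, the minimum of $D(K)$ over all $K\subseteq\Diamond$ with $\#K=i$ is attained by some $K'\subseteq\Box$. Consider the linear ramp secret sharing scheme defined from $C_2\subseteq C_1$: extend a basis $b_1,\dots,b_{k}$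 of $C_2$ to a basis $b_1,\dots,b_{k+\ell}$ of $C_1$; a secret $\sigma\in\mathbb{F}_q^\ell$ is encoded as $c=\sum_{i\le k}a_ib_i+\sum_{i\le\ell}\sigma_ib_{k+i}$ with random $a\in\mathbb F_q^k$, and the participant $\alpha\in S_1\times S_2$ receives $c_\alpha$. A set $A$ of participants obtains $\ell-\dim V$ $q$-bits of information if the secrets in accordance with its shares form an affine space $p+V\subseteq\mathbb{F}_q^\ell$. Let $r_m$ be the smallest $r$ such that every set of $r$ participants can recover (at least) $m$ $q$-bits of information. Call $A$ non-$m$-qualifying if it cannot recover $m$ $q$-bits, and maximum non-$m$-qualifying if it has the largest size among the non-$m$-qualifying sets. Let $M_e(C_1,C_2)$ be the minimum of $\#\mathrm{Supp}(E)$ over all linear $E\subseteq C_1$ with $E\cap C_2=\{0\}$ and $\dim E=e$, where $\mathrm{Supp}(E)$ is the set of positions in which some word of $E$ is nonzero. Then there are $n=s^2$ participants and the secret has size $\ell=(j-v+1)^2$. Every integer $e$ with $1\le e\le\ell$ can be written in exactly one of the following two ways, with unique integers $z,h$: $$\text{(1)}\quad e=z(z-1)-h,\qquad 2\le z\le\sqrt{\ell},\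 0\le h<z-1;$$ $$\text{(2)}\quad e=z^2-h,\qquad 1\le z\le\sqrt{\ell},\ 0\le h\le z-1.$$ In situation (1), $$M_e(C_1,C_2)=(s-j-1+z)(s-j-2+z)-h,\qquad r_{\ell-e+1}=s^2-(s-j-1+z)(s-j-2+z)+h+1 .$$ In situation (2), $$M_e(C_1,C_2)=(s-j-1+z)^2-h,\qquad r_{\ell-e+1}=s^2-(s-j-1+z)^2+h+1 .$$ Moreover, let $T_1\subseteq S_1$ and $T_2\subseteq S_2$, where $(\#T_1,\#T_2)$ is $(s-j-1+z,\,s-j-2+z)$ or $(s-j-2+z,\,s-j-1+z)$ in situation (1), and $(s-j-1+z,\,s-j-1+z)$ in situation (2), and let $U\subseteq T_1\times T_2$ with $\#U\le h$. Then the set of participants $A=(S_1\times S_2)\setminus\big((T_1\times T_2)\setminus U\big)$ obtains at most $\ell-e$ $q$-bits of information, and $A$ is maximum non-$(\ell-e+1)$-qualifying if and only if $\#U=h$. -/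

import Mathlib

/-!
# Linear ramp secret sharing from nested codes, and monomial-Cartesian schemes
-/

section Scheme

variable {F ι : Type*} [Field F]

/-- The size of the support of a linear code `D ⊆ F^ι`: the number of positions in which at least
one word of `D` is nonzero. -/
noncomputable def supportSize (D : Submodule F (ι → F)) : ℕ :=
  {i : ι | ∃ c ∈ D, c i ≠ 0}.ncard

/-- The `t`-th relative generalized Hamming weight `M_t(C₁, C₂)` of nested codes `C₂ ⊆ C₁`. -/
noncomputable def relGenHammingWeight (C₁ C₂ : Submodule F (ι → F)) (t : ℕ) : ℕ :=
  sInf {w : ℕ | ∃ D : Submodule F (ι → F),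
    D ≤ C₁ ∧ D ⊓ C₂ = ⊥ ∧ Module.finrank F D = t ∧ supportSize D = w}

/-- The coset construction of a linear ramp secret sharing scheme with participants `ι` and secrets
in `F^ℓ` from nested codes `C₂ ⊆ C₁ ⊆ F^ι`: a basis `mask` of `C₂` that is extended by `payload` to
a basis of `C₁`. -/
structure CosetScheme (C₂ C₁ : Submodule F (ι → F)) (k ℓ : ℕ) where
  mask : Fin k → ι → F
  payload : Fin ℓ → ι → F
  linearIndependent : LinearIndependent F (Sum.elim mask payload)
  span_mask : Submodule.span F (Set.range mask) = C₂
  span_mask_payload : Submodule.span F (Set.range (Sum.elim mask payload)) = C₁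

namespace CosetScheme

variable {C₂ C₁ : Submodule F (ι → F)} {k ℓ : ℕ}

/-- The vector of shares dealt for the secret `σ` when the random coefficients are `a`;
participant `i` receives the `i`-th entry. -/
def encode (scheme : CosetScheme C₂ C₁ k ℓ) (a : Fin k → F) (σ : Fin ℓ → F) : ι → F :=
  (∑ t, a t • scheme.mask t) + ∑ t, σ t • scheme.payload t

/-- The secrets that are in accordance with the shares that the participants in `A` hold when the
share vector `c` has been dealt. -/
def possibleSecrets (scheme : CosetScheme C₂ C₁ k ℓ) (A : Set ι) (c : ι → F) : Set (Fin ℓ → F) :=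
  {σ | ∃ a : Fin k → F, ∀ i ∈ A, scheme.encode a σ i = c i}

/-- The number `ℓ - dim V` of `q`-bits of information that the participants in `A` hold about the
secret when the share vector `c` has been dealt, where the set of possible secrets is the affine
space `p + V`. -/
noncomputable def information (scheme : CosetScheme C₂ C₁ k ℓ) (A : Set ι) (c : ι → F) : ℕ :=
  ℓ - Module.finrank F (vectorSpan F (scheme.possibleSecrets A c))

/-- `A` can recover `m` `q`-bits of information, whatever has been dealt. -/
def CanRecover (scheme : CosetScheme C₂ C₁ k ℓ) (A : Set ι) (m : ℕ) : Prop :=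
  ∀ a σ, m ≤ scheme.information A (scheme.encode a σ)

/-- `A` obtains at most `m` `q`-bits of information, whatever has been dealt. -/
def ObtainsAtMost (scheme : CosetScheme C₂ C₁ k ℓ) (A : Set ι) (m : ℕ) : Prop :=
  ∀ a σ, scheme.information A (scheme.encode a σ) ≤ m

/-- The reconstruction number `r_m`: the smallest `r` such that any set of `r` participants can
recover `m` `q`-bits of information. -/
noncomputable def reconstructionNumber (scheme : CosetScheme C₂ C₁ k ℓ) (m : ℕ) : ℕ :=
  sInf {r : ℕ | ∀ A : Set ι, A.ncard = r → scheme.CanRecover A m}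

/-- `A` is non-`m`-qualifying. -/
def NonQualifying (scheme : CosetScheme C₂ C₁ k ℓ) (m : ℕ) (A : Set ι) : Prop :=
  ¬ scheme.CanRecover A m

/-- `A` is maximum non-`m`-qualifying: of largest possible size among the non-`m`-qualifying
sets. -/
def MaximumNonQualifying (scheme : CosetScheme C₂ C₁ k ℓ) (m : ℕ) (A : Set ι) : Prop :=
  scheme.NonQualifying m A ∧ ∀ B : Set ι, scheme.NonQualifying m B → B.ncard ≤ A.ncard

end CosetScheme

end Scheme

section MonomialCartesian

variable {m : ℕ} {F : Type*} [Field F]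

/-- The point set `S₁ × ⋯ × S_m`. -/
abbrev CartesianPoint (S : Fin m → Finset F) : Type _ := (t : Fin m) → S t

/-- Evaluation of polynomials at the points of `S₁ × ⋯ × S_m`. -/
noncomputable def cartesianEval (S : Fin m → Finset F) :
    MvPolynomial (Fin m) F →ₗ[F] (CartesianPoint S → F) :=
  LinearMap.pi fun p => (MvPolynomial.aeval fun t => (p t : F)).toLinearMap

/-- The monomial-Cartesian code `C(L)`. A monomial `X₁^{i₁} ⋯ X_m^{i_m}` is given by its exponent
vector. -/
noncomputable def monomialCartesianCode (S : Fin m → Finset F) (L : Finset (Fin m → ℕ)) :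
    Submodule F (CartesianPoint S → F) :=
  (Submodule.span F
    ((fun i : Fin m → ℕ => ∏ t, (MvPolynomial.X t : MvPolynomial (Fin m) F) ^ i t) '' ↑L)).map
    (cartesianEval S)

end MonomialCartesian

section Considerate

variable {m : ℕ}

/-- `Δ(s₁, …, s_m)`: the monomials with exponent of `X_t` less than `s_t` for all `t`. -/
def monomialDelta (s : Fin m → ℕ) : Finset (Fin m → ℕ) :=
  Fintype.piFinset fun t => Finset.range (s t)

open Classical in
/-- `D(K)`: the number of monomials in `Δ(s₁, …, s_m)` that are divisible by some monomial
in `K`. -/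
noncomputable def shadowSize (s : Fin m → ℕ) (K : Finset (Fin m → ℕ)) : ℕ :=
  ((monomialDelta s).filter fun N => ∃ M ∈ K, ∀ t, M t ≤ N t).card

/-- `L₁`: the monomials with exponents `0 ≤ i_t ≤ j_t`. -/
def considerateL1 (j : Fin m → ℕ) : Finset (Fin m → ℕ) :=
  Fintype.piFinset fun t => Finset.Icc 0 (j t)

/-- `□`: the monomials with exponents `v_t ≤ i_t ≤ j_t`. -/
def considerateBox (v j : Fin m → ℕ) : Finset (Fin m → ℕ) :=
  Fintype.piFinset fun t => Finset.Icc (v t) (j t)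

/-- `L₂ = L₁ \ □`. -/
def considerateL2 (v j : Fin m → ℕ) : Finset (Fin m → ℕ) :=
  considerateL1 j \ considerateBox v j

open Classical in
/-- `◇`: the monomials of `L₁` that are not smaller than `X₁^{v₁} ⋯ X_m^{v_m}` in the lexicographic
ordering with `X_m ≺ ⋯ ≺ X₂ ≺ X₁`. -/
noncomputable def considerateDiamond (v j : Fin m → ℕ) : Finset (Fin m → ℕ) :=
  (considerateL1 j).filter fun M => toLex v ≤ toLex M

/-- The scheme defined from `C(L₂) ⊆ C(L₁)` over a point set with `#S_t = s_t` is considerate: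
`0 ≤ v_t < j_t < s_t` for all `t`, and for `i = 1, …, #□` the smallest value of `D(K)` over all
`K ⊆ ◇` of size `i` is attained by some `K' ⊆ □`. -/
def IsConsiderate (s v j : Fin m → ℕ) : Prop :=
  (∀ t, v t < j t ∧ j t < s t) ∧
    ∀ i, 1 ≤ i → i ≤ (considerateBox v j).card →
      ∃ K' ⊆ considerateBox v j, K'.card = i ∧
        ∀ K ⊆ considerateDiamond v j, K.card = i → shadowSize s K' ≤ shadowSize s K

end Considerate

/-- `e = z(z-1) - h` with `√ℓ ≥ z ≥ 2` and `0 ≤ h < z - 1`. -/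
def IsPronicForm (ℓ e z h : ℕ) : Prop :=
  (e : ℤ) = z * (z - 1) - h ∧ (z : ℝ) ≤ √(ℓ : ℝ) ∧ 2 ≤ z ∧ (h : ℤ) < z - 1

/-- `e = z² - h` with `√ℓ ≥ z ≥ 1` and `0 ≤ h ≤ z - 1`. -/
def IsSquareForm (ℓ e z h : ℕ) : Prop :=
  (e : ℤ) = z ^ 2 - h ∧ (z : ℝ) ≤ √(ℓ : ℝ) ∧ 1 ≤ z ∧ (h : ℤ) ≤ z - 1

/-! A set `A` misses at least `e` `q`-bits exactly when some `e`-dimensional `D ≤ C₁` with `D ⊓ C₂ =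
⊥` vanishes on `A`. The reconstruction numbers and the largest non-qualifying sets are therefore
governed by the least support size of such `D`. Write `m = s - j - 1`.

Lower bound. In lexicographic order, `D` has at least `e` leading monomials. They lie in `◇`, since
a word of `C₁` led by a monomial below `X₁ᵛX₂ᵛ` involves no monomial of the box and so lies in `C₂`.
Monomial multiples of words of `D` live on the support of `D`, so that support is at least as large
as the shadow of the leading monomials (`shadowSize_le_supportSize`). Considerateness moves the
minimization into the box. There, `e` monomials with bounding sides `p`, `q` (taken up to the corner
`(j, j)`) have shadow at least `m² + m(p + q) + e` (`exists_le_shadowSize`). It remains to minimize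
`p + q` subject to `e ≤ pq`: the optimum is `z + (z - 1)` for `(z - 1)² < e ≤ z(z - 1)` and `2z` for
`z(z - 1) < e ≤ z²`, which are the two situations.

Upper bound. On a rectangle with sides `m + p`, `m + q`, products of univariate polynomials
vanishing off the sides span a `pq`-dimensional space with leading monomials in the box
(`exists_submodule_of_rectangle`). Forcing zeros on `h` further points costs at most `h` dimensions,
leaving `pq - h = e`. The support bound `(m + p)(m + q) - h` equals the lower bound. -/

/-! ### Ramp schemes and subspaces of codes -/

section Scheme

variable {F ι : Type*} [Field F]

/-- The words that vanish at all positions in `A`. -/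
def vanishingOn (F : Type*) [Field F] (A : Set ι) : Submodule F (ι → F) where
  carrier := {f | ∀ i ∈ A, f i = 0}
  add_mem' hf hg i hi := by simp [hf i hi, hg i hi]
  zero_mem' _ _ := rfl
  smul_mem' c f hf i hi := by simp [hf i hi]

theorem vanishingOn_anti {A B : Set ι} (h : A ⊆ B) : vanishingOn F B ≤ vanishingOn F A :=
  fun _ hf i hi => hf i (h hi)

theorem finrank_vanishingOn_compl_le [Finite ι] (A : Set ι) :
    Module.finrank F (vanishingOn F Aᶜ) ≤ A.ncard := by
  classical
  have := Fintype.ofFinite ι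
  let φ : vanishingOn F Aᶜ →ₗ[F] (A → F) :=
    (LinearMap.funLeft F F (Subtype.val : A → ι)).comp (vanishingOn F Aᶜ).subtype
  have hφ : Function.Injective φ := by
    rw [injective_iff_map_eq_zero]
    rintro ⟨f, hf⟩ h
    ext i
    by_cases hi : i ∈ A
    · exact congrFun h ⟨i, hi⟩
    · exact hf i hi
  have := LinearMap.finrank_le_finrank_of_injective hφ
  rwa [Module.finrank_fintype_fun_eq_card, ← Nat.card_eq_fintype_card, Nat.card_coe_set_eq] at this

/-- Rank-nullity for restriction to `U`: each prescribed zero costs at most one dimension. -/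
theorem le_finrank_inf_vanishingOn [Finite ι] (G : Submodule F (ι → F)) (U : Set ι) :
    Module.finrank F G ≤ Module.finrank F ↥(G ⊓ vanishingOn F U) + U.ncard := by
  classical
  have := Fintype.ofFinite ι
  let φ : G →ₗ[F] (U → F) := (LinearMap.funLeft F F (Subtype.val : U → ι)).comp G.subtype
  have h := LinearMap.finrank_range_add_finrank_ker φ
  have h1 : Module.finrank F (LinearMap.range φ) ≤ U.ncard := by
    refine (Submodule.finrank_le _).trans ?_
    rw [Module.finrank_fintype_fun_eq_card, ← Nat.card_eq_fintype_card, Nat.card_coe_set_eq]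
  have h2 : Module.finrank F (LinearMap.ker φ) ≤ Module.finrank F ↥(G ⊓ vanishingOn F U) := by
    rw [← Submodule.finrank_map_subtype_eq]
    refine Submodule.finrank_mono ?_
    rintro _ ⟨f, hf, rfl⟩
    exact ⟨f.2, fun i hi => congrFun hf ⟨i, hi⟩⟩
  omega

theorem le_vanishingOn_iff {D : Submodule F (ι → F)} {A : Set ι} :
    D ≤ vanishingOn F A ↔ {i : ι | ∃ c ∈ D, c i ≠ 0} ⊆ Aᶜ := by
  constructor
  · rintro h i ⟨c, hc, hi⟩ hA
    exact hi (h hc i hA)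
  · intro h c hc i hi
    by_contra hne
    exact h ⟨c, hc, hne⟩ hi

theorem exists_submodule_finrank_eq {V : Type*} [AddCommGroup V] [Module F V]
    (W : Submodule F V) [FiniteDimensional F W] {e : ℕ} (he : e ≤ Module.finrank F W) :
    ∃ D ≤ W, Module.finrank F D = e := by
  let b := Module.finBasis F W
  let v : Fin e → V := fun i => b (Fin.castLE he i)
  have hv : LinearIndependent F v :=
    (b.linearIndependent.map' W.subtype W.ker_subtype).comp _ (Fin.castLE_injective he)
  refine ⟨Submodule.span F (Set.range v), ?_, ?_⟩
  · rw [Submodule.span_le]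
    rintro _ ⟨i, rfl⟩
    exact (b _).2
  · simpa using finrank_span_eq_card hv

theorem relGenHammingWeight_eq {D₁ D₂ : Submodule F (ι → F)} {e B : ℕ}
    (low : ∀ D ≤ D₁, D ⊓ D₂ = ⊥ → Module.finrank F D = e → B ≤ supportSize D)
    (up : ∃ D ≤ D₁, D ⊓ D₂ = ⊥ ∧ Module.finrank F D = e ∧ supportSize D ≤ B) :
    relGenHammingWeight D₁ D₂ e = B := by
  obtain ⟨D, h1, h2, h3, h4⟩ := up
  unfold relGenHammingWeight
  apply le_antisymm
  · refine le_trans (Nat.sInf_le ?_) h4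
    exact ⟨D, h1, h2, h3, rfl⟩
  · refine le_csInf ⟨_, D, h1, h2, h3, rfl⟩ ?_
    rintro w ⟨D', h1, h2, h3, rfl⟩
    exact low D' h1 h2 h3

namespace CosetScheme

variable {C₂ C₁ : Submodule F (ι → F)} {k ℓ : ℕ} (scheme : CosetScheme C₂ C₁ k ℓ)

/-- The dealing of shares as a linear map. -/
noncomputable def encodeLin : ((Fin k → F) × (Fin ℓ → F)) →ₗ[F] (ι → F) :=
  (Fintype.linearCombination F scheme.mask).coprod (Fintype.linearCombination F scheme.payload)

theorem encodeLin_apply (a : Fin k → F) (σ : Fin ℓ → F) :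
    scheme.encodeLin (a, σ) = scheme.encode a σ := by
  simp [encodeLin, encode, Fintype.linearCombination_apply]

theorem encodeLin_injective : Function.Injective scheme.encodeLin := by
  rw [injective_iff_map_eq_zero]
  rintro ⟨a, σ⟩ h
  have := Fintype.linearIndependent_iff.mp scheme.linearIndependent (Sum.elim a σ) (by
    rw [encodeLin_apply, encode] at h
    simpa using h)
  ext i
  · exact this (Sum.inl i)
  · exact this (Sum.inr i)

theorem range_encodeLin : LinearMap.range scheme.encodeLin = C₁ := by
  ext f
  conv_rhs => rw [← scheme.span_mask_payload]
  rw [Submodule.mem_span_range_iff_exists_fun, LinearMap.mem_range]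
  constructor
  · rintro ⟨⟨a, σ⟩, rfl⟩
    exact ⟨Sum.elim a σ, by simp [encodeLin_apply, encode]⟩
  · rintro ⟨c, rfl⟩
    exact ⟨(fun i => c (Sum.inl i), fun i => c (Sum.inr i)), by simp [encodeLin_apply, encode]⟩

theorem encodeLin_mem_iff (x : (Fin k → F) × (Fin ℓ → F)) :
    scheme.encodeLin x ∈ C₂ ↔ x.2 = 0 := by
  have h : ∀ f, f ∈ C₂ ↔ ∃ c : Fin k → F, ∑ i, c i • scheme.mask i = f := fun f => by
    rw [← Submodule.mem_span_range_iff_exists_fun, scheme.span_mask]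
  rw [h]
  constructor
  · rintro ⟨c, hc⟩
    have : scheme.encodeLin (c, 0) = scheme.encodeLin x := by
      rw [← hc]
      simp [encodeLin_apply, encode]
    rw [← scheme.encodeLin_injective this]
  · obtain ⟨a, σ⟩ := x
    rintro rfl
    exact ⟨a, by simp [encodeLin_apply, encode]⟩

theorem finrank_mask (scheme : CosetScheme C₂ C₁ k ℓ) : Module.finrank F C₂ = k := by
  have h : LinearIndependent F scheme.mask :=
    scheme.linearIndependent.comp Sum.inl Sum.inl_injective
  have h' := finrank_span_eq_card h
  rwa [scheme.span_mask, Fintype.card_fin] at h'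

theorem finrank_mask_payload (scheme : CosetScheme C₂ C₁ k ℓ) :
    Module.finrank F C₁ = k + ℓ := by
  have h := finrank_span_eq_card scheme.linearIndependent
  rwa [scheme.span_mask_payload, Fintype.card_sum, Fintype.card_fin, Fintype.card_fin] at h

/-- The secrets that are in accordance with all shares of `A` being zero. -/
noncomputable def hiddenSecrets (A : Set ι) : Submodule F (Fin ℓ → F) :=
  ((vanishingOn F A).comap scheme.encodeLin).map (LinearMap.snd F _ _)

theorem mem_hiddenSecrets {A : Set ι} {σ : Fin ℓ → F} :
    σ ∈ scheme.hiddenSecrets A ↔ ∃ a, ∀ i ∈ A, scheme.encode a σ i = 0 := by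
  constructor
  · rintro ⟨⟨a, τ⟩, h, rfl⟩
    refine ⟨a, fun i hi => ?_⟩
    rw [← encodeLin_apply]
    exact h i hi
  · rintro ⟨a, h⟩
    refine ⟨(a, σ), fun i hi => ?_, rfl⟩
    rw [encodeLin_apply]
    exact h i hi

theorem hiddenSecrets_anti {A B : Set ι} (h : A ⊆ B) :
    scheme.hiddenSecrets B ≤ scheme.hiddenSecrets A :=
  Submodule.map_mono (Submodule.comap_mono (vanishingOn_anti h))

/-- By linearity the possible secrets form a coset of `hiddenSecrets A`, so the amount of
information does not depend on what was dealt. -/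
theorem information_encode (A : Set ι) (a : Fin k → F) (σ : Fin ℓ → F) :
    scheme.information A (scheme.encode a σ) = ℓ - Module.finrank F (scheme.hiddenSecrets A) := by
  have h : scheme.possibleSecrets A (scheme.encode a σ) =
      (AffineSubspace.mk' σ (scheme.hiddenSecrets A) : Set (Fin ℓ → F)) := by
    ext τ
    rw [SetLike.mem_coe, AffineSubspace.mem_mk', vsub_eq_sub, mem_hiddenSecrets]
    have key : ∀ x y i, scheme.encode (x - y) (τ - σ) i =
        scheme.encode x τ i - scheme.encode y σ i := by
      intro x y i
      rw [← encodeLin_apply, ← encodeLin_apply, ← encodeLin_apply, ← Prod.mk_sub_mk, map_sub,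
        Pi.sub_apply]
    constructor
    · rintro ⟨x, hx⟩
      exact ⟨x - a, fun i hi => by rw [key, hx i hi, sub_self]⟩
    · rintro ⟨x, hx⟩
      refine ⟨x + a, fun i hi => ?_⟩
      rw [← sub_eq_zero, ← key, add_sub_cancel_right, hx i hi]
  rw [information, h, ← AffineSubspace.direction_eq_vectorSpan, AffineSubspace.direction_mk']

theorem finrank_hiddenSecrets_le (A : Set ι) :
    Module.finrank F (scheme.hiddenSecrets A) ≤ ℓ := by
  simpa using Submodule.finrank_le (scheme.hiddenSecrets A)

theorem obtainsAtMost_iff (A : Set ι) (m : ℕ) :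
    scheme.ObtainsAtMost A m ↔ ℓ - Module.finrank F (scheme.hiddenSecrets A) ≤ m := by
  simp [ObtainsAtMost, information_encode]

theorem nonQualifying_iff {e : ℕ} (he : e ≤ ℓ) (A : Set ι) :
    scheme.NonQualifying (ℓ - e + 1) A ↔ e ≤ Module.finrank F (scheme.hiddenSecrets A) := by
  have := scheme.finrank_hiddenSecrets_le A
  simp only [NonQualifying, CanRecover, information_encode, forall_const]
  omega

/-- Reading off the secret is injective on `D`, because words with secret zero are those of `C₂`. -/
theorem finrank_le_finrank_hiddenSecrets {A : Set ι} {D : Submodule F (ι → F)} (hD : D ≤ C₁)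
    (hD₂ : D ⊓ C₂ = ⊥) (hA : D ≤ vanishingOn F A) :
    Module.finrank F D ≤ Module.finrank F (scheme.hiddenSecrets A) := by
  let φ := (LinearMap.snd F (Fin k → F) (Fin ℓ → F)).domRestrict (D.comap scheme.encodeLin)
  have hφ : Function.Injective φ := by
    rw [injective_iff_map_eq_zero]
    rintro ⟨x, hx⟩ h
    have h2 : scheme.encodeLin x ∈ D ⊓ C₂ := ⟨hx, (scheme.encodeLin_mem_iff x).2 h⟩
    rw [hD₂, Submodule.mem_bot] at h2
    have : x = 0 := scheme.encodeLin_injective (by rw [h2, map_zero])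
    ext1
    exact this
  have h1 : Module.finrank F D = Module.finrank F (D.comap scheme.encodeLin) := by
    rw [(Submodule.equivMapOfInjective _ scheme.encodeLin_injective _).finrank_eq,
      Submodule.map_comap_eq, scheme.range_encodeLin, inf_eq_right.2 hD]
  rw [h1, ← LinearMap.finrank_range_of_inj hφ]
  refine Submodule.finrank_mono ?_
  rintro _ ⟨⟨x, hx⟩, rfl⟩
  exact ⟨x, hA hx, rfl⟩

/-- Converse of the preceding bound: a linear section lifts a space of hidden secrets to words that
vanish on `A`. A lifted word in `C₂` has secret zero, hence is zero. -/
theorem exists_of_le_finrank_hiddenSecrets {A : Set ι} {e : ℕ}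
    (he : e ≤ Module.finrank F (scheme.hiddenSecrets A)) :
    ∃ D ≤ C₁, D ⊓ C₂ = ⊥ ∧ Module.finrank F D = e ∧ D ≤ vanishingOn F A := by
  obtain ⟨W, hW, hWe⟩ := exists_submodule_finrank_eq _ he
  let φ := (LinearMap.snd F (Fin k → F) (Fin ℓ → F)).submoduleMap
    ((vanishingOn F A).comap scheme.encodeLin)
  obtain ⟨ψ, hψ⟩ := φ.exists_rightInverse_of_surjective
    (LinearMap.range_eq_top.2 (LinearMap.submoduleMap_surjective _ _))
  let θ : W →ₗ[F] ((Fin k → F) × (Fin ℓ → F)) :=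
    (Submodule.subtype _).comp (ψ.comp (Submodule.inclusion hW))
  have hθ : ∀ w : W, (θ w).2 = w := fun w =>
    congrArg Subtype.val (LinearMap.congr_fun hψ (Submodule.inclusion hW w))
  have hθ_inj : Function.Injective θ := fun x y h => Subtype.ext (by rw [← hθ, ← hθ, h])
  refine ⟨LinearMap.range (scheme.encodeLin.comp θ), ?_, ?_, ?_, ?_⟩
  · conv_rhs => rw [← scheme.range_encodeLin]
    exact LinearMap.range_comp_le_range _ _
  · rw [eq_bot_iff]
    rintro _ ⟨⟨w, rfl⟩, h⟩
    have : w = 0 := Subtype.ext (by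
      rw [← hθ]
      exact (scheme.encodeLin_mem_iff _).1 h)
    simp [this]
  · rw [LinearMap.finrank_range_of_inj
      (scheme.encodeLin_injective.comp hθ_inj : Function.Injective (scheme.encodeLin.comp θ)), hWe]
  · rintro _ ⟨w, rfl⟩
    exact (ψ (Submodule.inclusion hW w)).2

theorem nonQualifying_anti {m : ℕ} {A B : Set ι} (h : A ⊆ B) (hB : scheme.NonQualifying m B) :
    scheme.NonQualifying m A := by
  have := Submodule.finrank_mono (scheme.hiddenSecrets_anti h)
  simp only [NonQualifying, CanRecover, information_encode, forall_const] at hB ⊢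
  omega

theorem nonQualifying_compl_of_supportSize {e : ℕ} (he : e ≤ ℓ) {D : Submodule F (ι → F)}
    (hD : D ≤ C₁) (hD₂ : D ⊓ C₂ = ⊥) (hDe : Module.finrank F D = e) :
    scheme.NonQualifying (ℓ - e + 1) {i : ι | ∃ c ∈ D, c i ≠ 0}ᶜ := by
  rw [scheme.nonQualifying_iff he, ← hDe]
  exact scheme.finrank_le_finrank_hiddenSecrets hD hD₂ (le_vanishingOn_iff.2 (by simp))

variable [Finite ι]

theorem ncard_add_le_of_nonQualifying {e B : ℕ} (he : e ≤ ℓ)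
    (low : ∀ D ≤ C₁, D ⊓ C₂ = ⊥ → Module.finrank F D = e → B ≤ supportSize D)
    {A : Set ι} (hA : scheme.NonQualifying (ℓ - e + 1) A) : A.ncard + B ≤ Nat.card ι := by
  obtain ⟨D, h1, h2, h3, h4⟩ :=
    scheme.exists_of_le_finrank_hiddenSecrets ((scheme.nonQualifying_iff he A).1 hA)
  have h5 : supportSize D ≤ Aᶜ.ncard := Set.ncard_le_ncard (le_vanishingOn_iff.1 h4)
  have := low D h1 h2 h3
  rw [← Set.ncard_add_ncard_compl A]
  omega

theorem reconstructionNumber_eq {e B : ℕ} (he : e ≤ ℓ)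
    (low : ∀ D ≤ C₁, D ⊓ C₂ = ⊥ → Module.finrank F D = e → B ≤ supportSize D)
    (up : ∃ D ≤ C₁, D ⊓ C₂ = ⊥ ∧ Module.finrank F D = e ∧ supportSize D ≤ B) :
    scheme.reconstructionNumber (ℓ - e + 1) + B = Nat.card ι + 1 := by
  obtain ⟨D, h1, h2, h3, h4⟩ := up
  have hN := scheme.nonQualifying_compl_of_supportSize he h1 h2 h3
  have hB := scheme.ncard_add_le_of_nonQualifying he low hN
  have hc : ({i : ι | ∃ c ∈ D, c i ≠ 0}ᶜ).ncard + supportSize D = Nat.card ι := by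
    rw [add_comm]
    exact Set.ncard_add_ncard_compl _
  suffices scheme.reconstructionNumber (ℓ - e + 1) = Nat.card ι - B + 1 by omega
  apply le_antisymm
  · refine Nat.sInf_le fun A hA => ?_
    by_contra hA'
    have := scheme.ncard_add_le_of_nonQualifying he low hA'
    omega
  · refine le_csInf ⟨Nat.card ι - B + 1, fun A hA => ?_⟩ fun r hr => ?_
    · by_contra hA'
      have := scheme.ncard_add_le_of_nonQualifying he low hA'
      omega
    -- Fewer participants fit inside the complement of the support of `D`, and non-qualification
    -- passes to subsets.
    · by_contra! hlt
      obtain ⟨A, hA, hAr⟩ := Set.exists_subset_card_eq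
        (s := {i : ι | ∃ c ∈ D, c i ≠ 0}ᶜ) (n := r) (by omega)
      exact scheme.nonQualifying_anti hA hN (hr A hAr)

theorem maximumNonQualifying_iff {e B : ℕ} (he : e ≤ ℓ)
    (low : ∀ D ≤ C₁, D ⊓ C₂ = ⊥ → Module.finrank F D = e → B ≤ supportSize D)
    (up : ∃ D ≤ C₁, D ⊓ C₂ = ⊥ ∧ Module.finrank F D = e ∧ supportSize D ≤ B)
    {A : Set ι} (hA : scheme.NonQualifying (ℓ - e + 1) A) :
    scheme.MaximumNonQualifying (ℓ - e + 1) A ↔ Aᶜ.ncard = B := by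
  obtain ⟨D, h1, h2, h3, h4⟩ := up
  have hN := scheme.nonQualifying_compl_of_supportSize he h1 h2 h3
  have hB := scheme.ncard_add_le_of_nonQualifying he low hA
  have hc : ({i : ι | ∃ c ∈ D, c i ≠ 0}ᶜ).ncard + supportSize D = Nat.card ι := by
    rw [add_comm]
    exact Set.ncard_add_ncard_compl _
  have hc' := Set.ncard_add_ncard_compl A
  constructor
  · intro h
    have := h.2 _ hN
    omega
  · intro h
    refine ⟨hA, fun A' hA' => ?_⟩
    have := scheme.ncard_add_le_of_nonQualifying he low hA'
    omega

end CosetScheme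

end Scheme

/-! ### Leading indices of a subspace -/

section Echelon

variable {F V I : Type*} [Field F] [AddCommGroup V] [Module F V] [LinearOrder I]

/-- `N` is the leading index of `f` with respect to the ordered basis `b`, with coefficient `1`. -/
def IsLead (b : Module.Basis I F V) (f : V) (N : I) : Prop :=
  b.repr f N = 1 ∧ ∀ M, N < M → b.repr f M = 0

/-- The leading indices of the elements of `D`. -/
def leadSet (b : Module.Basis I F V) (D : Submodule F V) : Set I :=
  {N | ∃ f ∈ D, IsLead b f N}

theorem exists_isLead (b : Module.Basis I F V) {f : V} (hf : f ≠ 0) :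
    ∃ N, ∃ c : F, b.repr f N ≠ 0 ∧ IsLead b (c • f) N := by
  have hne : (b.repr f).support.Nonempty := by
    rw [Finsupp.support_nonempty_iff]
    simpa using hf
  have hN := Finsupp.mem_support_iff.1 ((b.repr f).support.max'_mem hne)
  refine ⟨(b.repr f).support.max' hne, (b.repr f ((b.repr f).support.max' hne))⁻¹, hN, ?_, ?_⟩
  · simp [inv_mul_cancel₀ hN]
  · intro M hM
    have : b.repr f M = 0 := by
      by_contra h
      exact absurd ((b.repr f).support.le_max' M (Finsupp.mem_support_iff.2 h)) (not_le.2 hM)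
    simp [this]

/-- A nonzero element has a nonzero coefficient at its own leading index, so its coefficients on
`leadSet b D` determine it. -/
theorem finrank_le_ncard_leadSet [Finite I] (b : Module.Basis I F V) (D : Submodule F V) :
    Module.finrank F D ≤ (leadSet b D).ncard := by
  classical
  have := Fintype.ofFinite I
  let φ : D →ₗ[F] (leadSet b D → F) :=
    (LinearMap.pi fun N : leadSet b D => b.coord N).comp D.subtype
  have hφ : Function.Injective φ := by
    rw [injective_iff_map_eq_zero]
    rintro ⟨f, hf⟩ h
    by_contra hne
    obtain ⟨N, c, h0, hN⟩ := exists_isLead b (f := f) (fun h => hne (Subtype.ext h))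
    exact h0 (congrFun h ⟨N, c • f, D.smul_mem _ hf, hN⟩)
  have := LinearMap.finrank_le_finrank_of_injective hφ
  rwa [Module.finrank_fintype_fun_eq_card, ← Nat.card_eq_fintype_card, Nat.card_coe_set_eq] at this

/-- The largest lead among the terms with nonzero coefficient cannot cancel. This gives both
independence and, later, trivial intersection with `C₂`. -/
theorem exists_repr_sum_ne_zero {κ : Type*} [Fintype κ] (b : Module.Basis I F V) {g : κ → V}
    {lead : κ → I} (hlead : Function.Injective lead) (hg : ∀ i, IsLead b (g i) (lead i))
    {c : κ → F} (hc : c ≠ 0) : ∃ i, b.repr (∑ i, c i • g i) (lead i) ≠ 0 := by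
  classical
  obtain ⟨i₀, hi₀⟩ := Function.ne_iff.1 hc
  obtain ⟨i, hi, hmax⟩ := (Finset.univ.filter fun i => c i ≠ 0).exists_max_image lead
    ⟨i₀, by simpa using hi₀⟩
  refine ⟨i, ?_⟩
  rw [map_sum, Finsupp.finsetSum_apply, Finset.sum_eq_single i]
  · simpa [(hg i).1] using hi
  · intro i' _ hne
    by_cases h0 : c i' = 0
    · simp [h0]
    · have hlt : lead i' < lead i :=
        lt_of_le_of_ne (hmax i' (by simpa using h0)) (hlead.ne hne)
      simp [(hg i').2 _ hlt]
  · simp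

theorem linearIndependent_of_isLead {κ : Type*} [Fintype κ] (b : Module.Basis I F V) {g : κ → V}
    {lead : κ → I} (hlead : Function.Injective lead) (hg : ∀ i, IsLead b (g i) (lead i)) :
    LinearIndependent F g := by
  rw [Fintype.linearIndependent_iff]
  intro c hc
  by_contra! h
  obtain ⟨i, hi⟩ := exists_repr_sum_ne_zero b hlead hg (Function.ne_iff.2 h)
  simp [hc] at hi

theorem ncard_leadSet_le [Finite I] (b : Module.Basis I F V) (D : Submodule F V) :
    (leadSet b D).ncard ≤ Module.finrank F D := by
  classical
  have := Fintype.ofFinite I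
  have : FiniteDimensional F V := b.finiteDimensional_of_finite
  choose g hgD hg using fun N : leadSet b D => N.2
  have hli : LinearIndependent F g := linearIndependent_of_isLead b Subtype.val_injective hg
  have hli' : LinearIndependent F fun N => (⟨g N, hgD N⟩ : D) :=
    LinearIndependent.of_comp D.subtype hli
  have := hli'.fintype_card_le_finrank
  rwa [← Nat.card_eq_fintype_card, Nat.card_coe_set_eq] at this

end Echelon

/-! ### Monomial basis of the words on the grid -/

section Grid

variable {F : Type*} [Field F]

/-- Lagrange interpolation; it reduces exponents that are too large. -/
theorem exists_pow_eq_sum {T : Finset F} {s : ℕ} (hT : T.card = s) (b : ℕ) :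
    ∃ γ : Fin s → F, ∀ y ∈ T, y ^ b = ∑ i, γ i * y ^ (i : ℕ) := by
  classical
  subst hT
  let P := Lagrange.interpolate T id fun y => y ^ b
  have hinj : Set.InjOn (id : F → F) T := Function.injective_id.injOn
  have hP : P ∈ Polynomial.degreeLT F T.card :=
    Polynomial.mem_degreeLT.2 (Lagrange.degree_interpolate_lt _ hinj)
  refine ⟨Polynomial.degreeLTEquiv F _ ⟨P, hP⟩, fun y hy => ?_⟩
  rw [← Polynomial.eval_eq_sum_degreeLTEquiv]
  exact (Lagrange.eval_interpolate_at_node _ hinj hy).symm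

theorem coeff_eq_zero_of_forall_sum_eq_zero {T : Finset F} {s : ℕ} (hT : T.card = s) {c : Fin s → F}
    (h : ∀ y ∈ T, ∑ i, c i * y ^ (i : ℕ) = 0) : c = 0 := by
  let f := (T.equivFinOfCardEq hT).symm
  exact Matrix.eq_zero_of_forall_index_sum_mul_pow_eq_zero (f := fun i => (f i : F))
    (Subtype.val_injective.comp f.injective) fun i => h _ (f i).2

/-- The word of values of the monomial `X₁ᵃ X₂ᵇ`. -/
def gridMonomial (S : Fin 2 → Finset F) (a b : ℕ) : CartesianPoint S → F :=
  fun p => (p 0 : F) ^ a * (p 1 : F) ^ b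

variable {S : Fin 2 → Finset F} {s : ℕ}

theorem monomialCartesianCode_eq_span (L : Finset (Fin 2 → ℕ)) :
    monomialCartesianCode S L =
      Submodule.span F ((fun i : Fin 2 → ℕ => gridMonomial S (i 0) (i 1)) '' L) := by
  rw [monomialCartesianCode, Submodule.map_span, Set.image_image]
  congr 2
  ext i p
  simp [cartesianEval, gridMonomial, Fin.prod_univ_two]

theorem card_cartesianPoint {F : Type*} {S : Fin 2 → Finset F} {s : ℕ} (hS : ∀ t, (S t).card = s) :
    Nat.card (CartesianPoint S) = s ^ 2 := by
  simp [Nat.card_eq_fintype_card, hS, sq]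

/-- The Vandermonde argument, applied in one variable and then in the other. -/
theorem linearIndependent_gridMonomial (hS : ∀ t, (S t).card = s) :
    LinearIndependent F fun n : Fin s × Fin s => gridMonomial S n.1 n.2 := by
  rw [Fintype.linearIndependent_iff]
  intro c hc
  have h : ∀ y ∈ S 1, ∀ x ∈ S 0, ∑ a : Fin s,
      (∑ b : Fin s, c (a, b) * y ^ (b : ℕ)) * x ^ (a : ℕ) = 0 := by
    intro y hy x hx
    have := congrFun hc ((piFinTwoEquiv fun t => S t).symm (⟨x, hx⟩, ⟨y, hy⟩))
    rw [Fintype.sum_prod_type] at this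
    simp only [Finset.sum_apply, Pi.smul_apply, gridMonomial, smul_eq_mul] at this
    refine Eq.trans ?_ this
    refine Finset.sum_congr rfl fun a _ => ?_
    rw [Finset.sum_mul]
    refine Finset.sum_congr rfl fun b _ => ?_
    simp
    ring
  rintro ⟨a, b⟩
  have h1 : (fun b => c (a, b)) = 0 := by
    refine coeff_eq_zero_of_forall_sum_eq_zero (hS 1) fun y hy => ?_
    exact congrFun (coeff_eq_zero_of_forall_sum_eq_zero (hS 0) (h y hy)) a
  exact congrFun h1 b

/-- The words of values of the monomials in `Δ(s, s)`, in lexicographic order. -/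
noncomputable def gridBasis (hS : ∀ t, (S t).card = s) :
    Module.Basis (Fin s ×ₗ Fin s) F (CartesianPoint S → F) :=
  (basisOfLinearIndependentOfCardEqFinrank' _ (linearIndependent_gridMonomial hS) (by
    simp [Module.finrank_fintype_fun_eq_card, hS, sq])).reindex toLex

theorem gridBasis_toLex (hS : ∀ t, (S t).card = s) (n : Fin s × Fin s) :
    gridBasis hS (toLex n) = gridMonomial S n.1 n.2 := by
  simp [gridBasis]

end Grid

/-! ### Leading monomials and the shadow bound -/

section Grid

variable {F : Type*} [Field F] {S : Fin 2 → Finset F} {s : ℕ}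

theorem gridBasis_repr_gridMonomial (hS : ∀ t, (S t).card = s) {a b : ℕ} (ha : a < s) (hb : b < s)
    (n : Fin s ×ₗ Fin s) : (gridBasis hS).repr (gridMonomial S a b) n =
      if (ofLex n).1 = a ∧ (ofLex n).2 = b then 1 else 0 := by
  classical
  have h : gridMonomial S a b = gridBasis hS (toLex (⟨a, ha⟩, ⟨b, hb⟩)) := by
    rw [gridBasis_toLex]
  rw [h, Module.Basis.repr_self, Finsupp.single_apply]
  refine if_congr ?_ rfl rfl
  rw [← ofLex.injective.eq_iff, Prod.ext_iff, Fin.ext_iff, Fin.ext_iff]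
  simp [eq_comm]

/-- Reducing a large exponent of `X₂` leaves the exponent of `X₁` alone. -/
theorem gridBasis_repr_gridMonomial_of_ne (hS : ∀ t, (S t).card = s) {a b : ℕ} (ha : a < s)
    {n : Fin s ×ₗ Fin s} (hn : (ofLex n).1 ≠ a) :
    (gridBasis hS).repr (gridMonomial S a b) n = 0 := by
  obtain ⟨γ, hγ⟩ := exists_pow_eq_sum (hS 1) b
  have h : gridMonomial S a b = ∑ i : Fin s, γ i • gridMonomial S a i := by
    ext p
    simp only [gridMonomial, Finset.sum_apply, Pi.smul_apply, smul_eq_mul]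
    rw [hγ _ (p 1).2, Finset.mul_sum]
    exact Finset.sum_congr rfl fun _ _ => by ring
  simp [h, map_sum, Finsupp.finsetSum_apply, gridBasis_repr_gridMonomial hS ha, hn]

/-- A smaller term of `f` may leave the grid after multiplication, but only in `X₂` and only if its
`X₁`-exponent is below that of the lead. Its reduction then keeps that smaller `X₁`-exponent and
stays lexicographically below `N'`. -/
theorem isLead_gridMonomial_mul (hS : ∀ t, (S t).card = s) {f : CartesianPoint S → F}
    {N N' : Fin s ×ₗ Fin s} (hf : IsLead (gridBasis hS) f N) {i j : ℕ}
    (h1 : ((ofLex N').1 : ℕ) = (ofLex N).1 + i) (h2 : ((ofLex N').2 : ℕ) = (ofLex N).2 + j) :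
    IsLead (gridBasis hS) (gridMonomial S i j * f) N' := by
  classical
  have hsum : gridMonomial S i j * f = ∑ M, (gridBasis hS).repr f M •
      gridMonomial S ((ofLex M).1 + i) ((ofLex M).2 + j) := by
    conv_lhs => rw [← (gridBasis hS).sum_repr f, Finset.mul_sum]
    refine Finset.sum_congr rfl fun M _ => ?_
    have := gridBasis_toLex hS (ofLex M)
    rw [toLex_ofLex] at this
    rw [this]
    ext p
    simp only [gridMonomial, Pi.mul_apply, Pi.smul_apply, smul_eq_mul]
    ring
  have key : ∀ P, N' ≤ P → (gridBasis hS).repr (gridMonomial S i j * f) P =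
      if P = N' then 1 else 0 := by
    intro P hP
    rw [hsum, map_sum, Finsupp.finsetSum_apply, Finset.sum_eq_single N]
    · rw [map_smul, Finsupp.smul_apply, hf.1, ← h1, ← h2,
        gridBasis_repr_gridMonomial hS (Fin.is_lt _) (Fin.is_lt _), one_smul]
      refine if_congr ?_ rfl rfl
      rw [← ofLex.injective.eq_iff, Prod.ext_iff, Fin.ext_iff, Fin.ext_iff]
    · intro M _ hM
      rw [map_smul, Finsupp.smul_apply, smul_eq_mul, mul_eq_zero]
      rcases lt_or_gt_of_ne hM with h | h
      · right
        rw [Prod.Lex.le_iff, Fin.lt_def, Fin.ext_iff, Fin.le_def] at hP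
        rw [Prod.Lex.lt_iff, Fin.lt_def, Fin.ext_iff, Fin.lt_def] at h
        have b1 := (ofLex N').1.is_lt
        have b2 := (ofLex N').2.is_lt
        by_cases hne : ((ofLex P).1 : ℕ) = (ofLex M).1 + i
        · rw [gridBasis_repr_gridMonomial hS (by omega) (by omega), if_neg (by omega)]
        · exact gridBasis_repr_gridMonomial_of_ne hS (by omega) hne
      · exact Or.inl (hf.2 _ h)
    · simp
  exact ⟨by simp [key], fun P hP => by rw [key P hP.le, if_neg hP.ne']⟩

/-- The exponent vector that belongs to a basis index. -/
def gridIndex (n : Fin s ×ₗ Fin s) : Fin 2 → ℕ := ![(ofLex n).1, (ofLex n).2]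

theorem gridIndex_injective : Function.Injective (gridIndex (s := s)) := by
  intro m n h
  rw [← ofLex.injective.eq_iff, Prod.ext_iff, Fin.ext_iff, Fin.ext_iff]
  exact ⟨congrFun h 0, congrFun h 1⟩

theorem exists_gridIndex_eq {M : Fin 2 → ℕ} (hM : ∀ t, M t < s) : ∃ n, gridIndex (s := s) n = M := by
  refine ⟨toLex (⟨M 0, hM 0⟩, ⟨M 1, hM 1⟩), ?_⟩
  ext t
  fin_cases t <;> rfl

theorem gridBasis_eq (hS : ∀ t, (S t).card = s) (n : Fin s ×ₗ Fin s) :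
    gridBasis hS n = gridMonomial S (gridIndex n 0) (gridIndex n 1) :=
  gridBasis_toLex hS (ofLex n)

/-- All words living on the support of `D` form a space of dimension at most the support size. It is
closed under multiplication by monomials, so its leading set contains the whole shadow of `K`. -/
theorem shadowSize_le_supportSize (hS : ∀ t, (S t).card = s)
    {D : Submodule F (CartesianPoint S → F)} {K : Finset (Fin 2 → ℕ)}
    (hK : (K : Set (Fin 2 → ℕ)) ⊆ gridIndex '' leadSet (gridBasis hS) D) :
    shadowSize (fun _ => s) K ≤ supportSize D := by
  classical
  let A := {i | ∃ c ∈ D, c i ≠ 0}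
  refine le_trans ?_ (finrank_vanishingOn_compl_le (F := F) A)
  refine le_trans ?_ (ncard_leadSet_le (gridBasis hS) _)
  refine le_trans ?_ (Set.ncard_image_le (f := gridIndex))
  rw [shadowSize, ← Set.ncard_coe_finset]
  refine Set.ncard_le_ncard ?_
  intro N hN
  simp only [monomialDelta, Finset.coe_filter, Fintype.mem_piFinset, Finset.mem_range,
    Set.mem_ofPred_eq] at hN
  obtain ⟨hNs, M, hM, hMN⟩ := hN
  obtain ⟨n, ⟨f, hf, hfn⟩, rfl⟩ := hK hM
  obtain ⟨n', rfl⟩ := exists_gridIndex_eq hNs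
  refine ⟨n', ⟨_, ?_, isLead_gridMonomial_mul hS hfn (i := gridIndex n' 0 - gridIndex n 0)
    (j := gridIndex n' 1 - gridIndex n 1) (Nat.add_sub_cancel' (hMN 0)).symm
    (Nat.add_sub_cancel' (hMN 1)).symm⟩, rfl⟩
  intro p hp
  have : f p = 0 := by
    by_contra h
    exact hp ⟨f, hf, h⟩
  simp [this]

theorem mem_monomialCartesianCode_iff (hS : ∀ t, (S t).card = s) {L : Finset (Fin 2 → ℕ)}
    (hL : ∀ M ∈ L, ∀ t, M t < s) (f : CartesianPoint S → F) :
    f ∈ monomialCartesianCode S L ↔ ∀ n, (gridBasis hS).repr f n ≠ 0 → gridIndex n ∈ L := by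
  have h : (fun i : Fin 2 → ℕ => gridMonomial S (i 0) (i 1)) '' L =
      gridBasis hS '' (gridIndex ⁻¹' L) := by
    ext g
    constructor
    · rintro ⟨M, hM, rfl⟩
      obtain ⟨n, rfl⟩ := exists_gridIndex_eq (hL M hM)
      exact ⟨n, hM, gridBasis_eq hS n⟩
    · rintro ⟨n, hn, rfl⟩
      exact ⟨_, hn, (gridBasis_eq hS n).symm⟩
  rw [monomialCartesianCode_eq_span, h, Module.Basis.mem_span_image]
  simp [Set.subset_def]

theorem finrank_monomialCartesianCode (hS : ∀ t, (S t).card = s) {L : Finset (Fin 2 → ℕ)}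
    (hL : ∀ M ∈ L, ∀ t, M t < s) : Module.finrank F (monomialCartesianCode S L) = L.card := by
  classical
  choose φ hφ using fun M : L => exists_gridIndex_eq (hL M M.2)
  have hinj : Function.Injective φ := fun x y h => Subtype.ext (by rw [← hφ, ← hφ, h])
  have h := finrank_span_eq_card ((gridBasis hS).linearIndependent.comp φ hinj)
  rw [Fintype.card_coe] at h
  rw [← h, monomialCartesianCode_eq_span, Set.image_eq_range]
  have hfun : (fun M : L => gridMonomial S (M.1 0) (M.1 1)) = gridBasis hS ∘ φ := by
    funext M
    rw [Function.comp_apply, gridBasis_eq, hφ]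
  rw [← hfun]
  rfl

theorem considerateL1_lt {j : ℕ} (hj : j < s) : ∀ M ∈ considerateL1 fun _ : Fin 2 => j,
    ∀ t, M t < s := by
  intro M hM t
  simp only [considerateL1, Fintype.mem_piFinset, Finset.mem_Icc] at hM
  exact (hM t).2.trans_lt hj

theorem considerateL2_lt {v j : ℕ} (hj : j < s) :
    ∀ M ∈ considerateL2 (fun _ : Fin 2 => v) fun _ => j, ∀ t, M t < s :=
  fun M hM => considerateL1_lt hj M (Finset.sdiff_subset hM)

theorem exists_subset_considerateDiamond (hS : ∀ t, (S t).card = s) {v j e : ℕ} (hj : j < s)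
    {D : Submodule F (CartesianPoint S → F)}
    (hD : D ≤ monomialCartesianCode S (considerateL1 fun _ => j))
    (hD₂ : D ⊓ monomialCartesianCode S (considerateL2 (fun _ => v) fun _ => j) = ⊥)
    (he : Module.finrank F D = e) :
    ∃ K ⊆ considerateDiamond (fun _ : Fin 2 => v) fun _ => j, K.card = e ∧
      (K : Set (Fin 2 → ℕ)) ⊆ gridIndex '' leadSet (gridBasis hS) D := by
  classical
  have hcard : e ≤ (gridIndex '' leadSet (gridBasis hS) D).ncard := by
    rw [Set.ncard_image_of_injective _ gridIndex_injective, ← he]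
    exact finrank_le_ncard_leadSet _ _
  obtain ⟨K, hK, hKe⟩ := Set.exists_subset_card_eq hcard
  have hfin : K.Finite := (Set.toFinite _).subset hK
  refine ⟨hfin.toFinset, ?_, by rw [← hKe, Set.ncard_eq_toFinset_card _ hfin], by simpa using hK⟩
  intro M hM
  obtain ⟨n, ⟨f, hf, hfn⟩, rfl⟩ := hK (hfin.mem_toFinset.1 hM)
  have hL1 := (mem_monomialCartesianCode_iff hS (considerateL1_lt hj) f).1 (hD hf)
  simp only [considerateDiamond, Finset.mem_filter]
  refine ⟨hL1 n (by simp [hfn.1]), ?_⟩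
  by_contra hlt
  rw [not_le] at hlt
  have hf2 : f ∈ D ⊓ monomialCartesianCode S (considerateL2 (fun _ => v) fun _ => j) := by
    refine ⟨hf, (mem_monomialCartesianCode_iff hS (considerateL2_lt hj) f).2 fun m hm => ?_⟩
    refine Finset.mem_sdiff.2 ⟨hL1 m hm, fun hbox => ?_⟩
    -- A box monomial has both exponents at least `v`, so it cannot be at most a lead that is
    -- lexicographically below `(v, v)`.
    have hmn : m ≤ n := by
      by_contra h
      exact hm (hfn.2 m (not_le.1 h))
    simp only [considerateBox, Fintype.mem_piFinset, Finset.mem_Icc] at hbox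
    have b0 := (hbox 0).1
    have b1 := (hbox 1).1
    simp only [gridIndex, Matrix.cons_val_zero, Matrix.cons_val_one] at b0 b1
    rw [Prod.Lex.le_iff, Fin.lt_def, Fin.ext_iff, Fin.le_def] at hmn
    obtain ⟨t, ht1, ht2⟩ := hlt
    fin_cases t
    · simp [gridIndex] at ht2
      omega
    · have := ht1 0 (by simp)
      simp [gridIndex] at this ht2
      omega
  rw [hD₂, Submodule.mem_bot] at hf2
  simpa [hf2] using hfn.1

/-! ### Words supported on a rectangle -/

theorem repr_eval_mul_eval (hS : ∀ t, (S t).card = s) {P Q : Polynomial F} (hP : P.natDegree < s)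
    (hQ : Q.natDegree < s) (n : Fin s ×ₗ Fin s) :
    (gridBasis hS).repr (fun p => P.eval (p 0 : F) * Q.eval (p 1 : F)) n =
      P.coeff (gridIndex n 0) * Q.coeff (gridIndex n 1) := by
  have h : (fun p : CartesianPoint S => P.eval (p 0 : F) * Q.eval (p 1 : F)) =
      ∑ n : Fin s ×ₗ Fin s, (P.coeff (gridIndex n 0) * Q.coeff (gridIndex n 1)) •
        gridBasis hS n := by
    ext p
    rw [← toLex.sum_comp, Fintype.sum_prod_type, Polynomial.eval_eq_sum_range' hP,
      Polynomial.eval_eq_sum_range' hQ, Finset.sum_mul_sum, Finset.sum_apply]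
    simp only [Finset.sum_range, Finset.sum_apply, Pi.smul_apply, smul_eq_mul, gridBasis_toLex,
      gridMonomial, gridIndex, ofLex_toLex, Matrix.cons_val_zero, Matrix.cons_val_one]
    exact Finset.sum_congr rfl fun _ _ => Finset.sum_congr rfl fun _ _ => by ring
  rw [h, Module.Basis.repr_sum_self]

/-- The product of the linear factors off `T`, with `X ^ i` to spread the degrees. -/
theorem exists_polynomial_vanishing_off {S : Finset F} (T : Set S) (i : ℕ) :
    ∃ P : Polynomial F, P.Monic ∧ P.natDegree = S.card - T.ncard + i ∧
      ∀ x : S, x ∉ T → P.eval (x : F) = 0 := by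
  classical
  refine ⟨(∏ x ∈ Tᶜ.toFinset, (Polynomial.X - Polynomial.C (x : F))) * Polynomial.X ^ i,
    ?_, ?_, ?_⟩
  · exact (Polynomial.monic_prod_of_monic _ _ fun x _ => Polynomial.monic_X_sub_C _).mul
      (Polynomial.monic_X_pow i)
  · rw [Polynomial.Monic.natDegree_mul
      (Polynomial.monic_prod_of_monic _ _ fun x _ => Polynomial.monic_X_sub_C _)
      (Polynomial.monic_X_pow i), Polynomial.natDegree_X_pow,
      Polynomial.natDegree_prod_of_monic _ _ fun x _ => Polynomial.monic_X_sub_C _]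
    have := Set.ncard_add_ncard_compl T
    rw [Nat.card_eq_fintype_card, Fintype.card_coe] at this
    simp only [Polynomial.natDegree_X_sub_C, Finset.sum_const, smul_eq_mul, mul_one,
      ← Set.ncard_eq_toFinset_card']
    omega
  · intro x hx
    rw [Polynomial.eval_mul, Polynomial.eval_prod,
      Finset.prod_eq_zero (i := x) (by simpa using hx) (by simp), zero_mul]

/-- The sides make the degrees run through `j + 1 - p, …, j` and `j + 1 - q, …, j`, so the `pq`
products have distinct leads, all inside the box. A nonzero combination thus has a nonzero
coefficient in the box and is not in `C₂`. -/
theorem exists_submodule_of_rectangle (hS : ∀ t, (S t).card = s) {v j p q : ℕ} (hj : j < s)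
    (hp : v + p ≤ j + 1) (hq : v + q ≤ j + 1) (T : (t : Fin 2) → Set (S t))
    (hT₀ : (T 0).ncard + (j + 1) = s + p) (hT₁ : (T 1).ncard + (j + 1) = s + q) :
    ∃ G ≤ monomialCartesianCode S (considerateL1 fun _ => j),
      G ⊓ monomialCartesianCode S (considerateL2 (fun _ => v) fun _ => j) = ⊥ ∧
      Module.finrank F G = p * q ∧ G ≤ vanishingOn F (Set.univ.pi T)ᶜ := by
  classical
  choose P hPm hPd hPv using fun i => exists_polynomial_vanishing_off (T 0) i
  choose Q hQm hQd hQv using fun i => exists_polynomial_vanishing_off (T 1) i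
  rw [hS] at hPd hQd
  let g : Fin p × Fin q → CartesianPoint S → F := fun i x =>
    (P i.1).eval (x 0 : F) * (Q i.2).eval (x 1 : F)
  have hP : ∀ i : Fin p, (P i).natDegree ≤ j := fun i => by rw [hPd]; omega
  have hQ : ∀ i : Fin q, (Q i).natDegree ≤ j := fun i => by rw [hQd]; omega
  have hrepr : ∀ i n, (gridBasis hS).repr (g i) n =
      (P i.1).coeff (gridIndex n 0) * (Q i.2).coeff (gridIndex n 1) := fun i n =>
    repr_eval_mul_eval hS ((hP _).trans_lt hj) ((hQ _).trans_lt hj) n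
  let lead : Fin p × Fin q → Fin s ×ₗ Fin s := fun i =>
    toLex (⟨(P i.1).natDegree, (hP _).trans_lt hj⟩, ⟨(Q i.2).natDegree, (hQ _).trans_lt hj⟩)
  have hlead : Function.Injective lead := by
    rintro ⟨a, b⟩ ⟨a', b'⟩ h
    have h' := toLex.injective h
    simp only [Prod.mk.injEq, Fin.mk.injEq, hPd, hQd, Nat.add_left_cancel_iff] at h'
    exact Prod.ext (Fin.ext h'.1) (Fin.ext h'.2)
  have hg : ∀ i, IsLead (gridBasis hS) (g i) (lead i) := by
    intro i
    refine ⟨?_, fun M hM => ?_⟩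
    · rw [hrepr]
      have h1 := hPm i.1
      have h2 := hQm i.2
      simp only [gridIndex, lead, ofLex_toLex, Matrix.cons_val_zero, Matrix.cons_val_one]
      rw [Polynomial.Monic.coeff_natDegree h1, Polynomial.Monic.coeff_natDegree h2, one_mul]
    · rw [hrepr]
      rw [Prod.Lex.lt_iff, Fin.lt_def, Fin.ext_iff, Fin.lt_def] at hM
      rcases hM with h | ⟨_, h⟩
      · rw [Polynomial.coeff_eq_zero_of_natDegree_lt (p := P i.1) (n := gridIndex M 0) h, zero_mul]
      · rw [Polynomial.coeff_eq_zero_of_natDegree_lt (p := Q i.2) (n := gridIndex M 1) h, mul_zero]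
  refine ⟨Submodule.span F (Set.range g), ?_, ?_, ?_, ?_⟩
  · rw [Submodule.span_le]
    rintro _ ⟨i, rfl⟩
    refine (mem_monomialCartesianCode_iff hS (considerateL1_lt hj) _).2 fun n hn => ?_
    rw [hrepr] at hn
    have h0 := (Polynomial.le_natDegree_of_ne_zero (left_ne_zero_of_mul hn)).trans (hP _)
    have h1 := (Polynomial.le_natDegree_of_ne_zero (right_ne_zero_of_mul hn)).trans (hQ _)
    simp only [considerateL1, Fintype.mem_piFinset, Finset.mem_Icc, zero_le, true_and]
    intro t
    fin_cases t
    exacts [h0, h1]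
  · rw [eq_bot_iff]
    rintro f ⟨hf, hf₂⟩
    obtain ⟨c, rfl⟩ := Submodule.mem_span_range_iff_exists_fun F |>.1 hf
    rw [Submodule.mem_bot]
    by_contra hne
    have hc : c ≠ 0 := by
      rintro rfl
      simp at hne
    obtain ⟨i, hi⟩ := exists_repr_sum_ne_zero (gridBasis hS) hlead hg hc
    have := (mem_monomialCartesianCode_iff hS (considerateL2_lt hj) _).1 hf₂ _ hi
    refine (Finset.mem_sdiff.1 this).2 ?_
    simp only [considerateBox, Fintype.mem_piFinset, Finset.mem_Icc]
    intro t
    fin_cases t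
    · refine ⟨?_, hP i.1⟩
      simp [gridIndex, lead, hPd]
      omega
    · refine ⟨?_, hQ i.2⟩
      simp [gridIndex, lead, hQd]
      omega
  · simpa using finrank_span_eq_card (linearIndependent_of_isLead (gridBasis hS) hlead hg)
  · rw [Submodule.span_le]
    rintro _ ⟨i, rfl⟩ x hx
    simp only [Set.mem_compl_iff, Set.mem_univ_pi, not_forall] at hx
    obtain ⟨t, ht⟩ := hx
    fin_cases t
    · simp [g, hPv i.1 (x 0) ht]
    · simp [g, hQv i.2 (x 1) ht]

end Grid

/-! ### Counting shadows and minimizing the half-perimeter -/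

theorem exists_le_shadowSize {s v j : ℕ} {K : Finset (Fin 2 → ℕ)}
    (hK : K ⊆ considerateBox (fun _ => v) fun _ => j) (hne : K.Nonempty) (hj : j < s) :
    ∃ p q, K.card ≤ p * q ∧
      (s - j - 1) ^ 2 + (s - j - 1) * (p + q) + K.card ≤ shadowSize (fun _ => s) K := by
  classical
  have hbox : ∀ M ∈ K, M 0 ≤ j ∧ M 1 ≤ j := fun M hM => by
    have := hK hM
    simp only [considerateBox, Fintype.mem_piFinset, Finset.mem_Icc] at this
    exact ⟨(this 0).2, (this 1).2⟩
  obtain ⟨A, hA, hAmin⟩ := K.exists_min_image (fun M => M 0) hne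
  obtain ⟨B, hB, hBmin⟩ := K.exists_min_image (fun M => M 1) hne
  let e := (finTwoArrowEquiv ℕ).symm.toEmbedding
  -- Outside the square `[0, j]²`, `B` alone accounts for `Y₁` and `A` alone for `Y₂`. Inside it,
  -- only `K` itself is counted.
  let Y₁ := Finset.Ico (j + 1) s ×ˢ Finset.Ico (B 1) s
  let Y₂ := Finset.Ico (A 0) (j + 1) ×ˢ Finset.Ico (j + 1) s
  have hY : Disjoint Y₁ Y₂ := by
    rw [Finset.disjoint_left]
    rintro ⟨x, y⟩ h1 h2
    simp only [Y₁, Y₂, Finset.mem_product, Finset.mem_Ico] at h1 h2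
    omega
  have hKY : Disjoint K ((Y₁ ∪ Y₂).map e) := by
    rw [Finset.disjoint_left]
    intro M hM h
    obtain ⟨⟨x, y⟩, hxy, rfl⟩ := Finset.mem_map.1 h
    have := hbox _ hM
    simp only [Y₁, Y₂, e, Finset.mem_union, Finset.mem_product, Finset.mem_Ico,
      Equiv.coe_toEmbedding, finTwoArrowEquiv_symm_apply, Matrix.cons_val_zero,
      Matrix.cons_val_one] at hxy this
    omega
  have hA' := hbox A hA
  have hB' := hbox B hB
  have hsub : K ∪ (Y₁ ∪ Y₂).map e ⊆
      (monomialDelta fun _ => s).filter fun N => ∃ M ∈ K, ∀ t, M t ≤ N t := by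
    intro N hN
    simp only [Finset.mem_filter, monomialDelta, Fintype.mem_piFinset, Finset.mem_range,
      Fin.forall_fin_two]
    rcases Finset.mem_union.1 hN with h | h
    · have := hbox N h
      exact ⟨⟨by omega, by omega⟩, N, h, le_rfl, le_rfl⟩
    · obtain ⟨⟨x, y⟩, hxy, rfl⟩ := Finset.mem_map.1 h
      simp only [Y₁, Y₂, e, Finset.mem_union, Finset.mem_product, Finset.mem_Ico,
        Equiv.coe_toEmbedding, finTwoArrowEquiv_symm_apply, Matrix.cons_val_zero,
        Matrix.cons_val_one] at hxy ⊢
      refine ⟨by omega, ?_⟩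
      rcases hxy with h | h
      · exact ⟨B, hB, by omega, by omega⟩
      · exact ⟨A, hA, by omega, by omega⟩
  refine ⟨j + 1 - A 0, j + 1 - B 1, ?_, ?_⟩
  · have : K ⊆ (Finset.Ico (A 0) (j + 1) ×ˢ Finset.Ico (B 1) (j + 1)).map e := by
      intro M hM
      refine Finset.mem_map.2 ⟨(M 0, M 1), ?_, (finTwoArrowEquiv ℕ).symm_apply_apply M⟩
      have h0 := hAmin M hM
      have h1 := hBmin M hM
      have h2 := hbox M hM
      simp only [Finset.mem_product, Finset.mem_Ico]
      omega
    simpa using Finset.card_le_card this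
  · have h := Finset.card_le_card hsub
    rw [Finset.card_union_of_disjoint hKY, Finset.card_map, Finset.card_union_of_disjoint hY] at h
    simp only [Y₁, Y₂, Finset.card_product, Nat.card_Ico] at h
    refine le_trans (le_of_eq ?_) h
    obtain ⟨m, rfl⟩ : ∃ m, s = j + 1 + m := ⟨s - (j + 1), by omega⟩
    obtain ⟨b, hb⟩ : ∃ b, j + 1 = B 1 + b := ⟨j + 1 - B 1, by omega⟩
    have h1 : j + 1 + m - j - 1 = m := by omega
    have h2 : j + 1 + m - (j + 1) = m := by omega
    have h3 : j + 1 + m - B 1 = m + b := by omega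
    have h4 : j + 1 - B 1 = b := by omega
    rw [h1, h2, h3, h4]
    ring

/-- Integers with sum at most `2z - 1` have product at most `z(z - 1)`. -/
theorem add_self_le_add_of_mul_pred_lt {z p q e : ℕ} (he : e ≤ p * q) (hz : z * (z - 1) < e) :
    z + z ≤ p + q := by
  by_contra! h
  obtain ⟨y, rfl⟩ : ∃ y, z = y + 1 := ⟨z - 1, by omega⟩
  rw [Nat.add_sub_cancel] at hz
  have h1 : p * q ≤ y * (y + 1) := by
    rcases le_total p q with hpq | hpq
    · have hp : p ≤ y := by omega
      zify at *
      -- `y(y + 1) - p(2y + 1 - p) = (y - p)² + (y - p)`.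
      nlinarith [mul_nonneg (sub_nonneg.2 hp) (sub_nonneg.2 hp)]
    · have hp : q ≤ y := by omega
      zify at *
      nlinarith [mul_nonneg (sub_nonneg.2 hp) (sub_nonneg.2 hp)]
  linarith [mul_comm y (y + 1)]

theorem add_pred_le_add_of_sq_lt {z p q e : ℕ} (he : e ≤ p * q) (hz : (z - 1) ^ 2 < e) :
    z + (z - 1) ≤ p + q := by
  by_contra! h
  obtain rfl | ⟨y, rfl⟩ : z = 0 ∨ ∃ y, z = y + 1 := by
    rcases z with _ | y
    exacts [Or.inl rfl, Or.inr ⟨y, rfl⟩]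
  · omega
  rw [Nat.add_sub_cancel] at *
  have h1 : p + q ≤ 2 * y := by omega
  zify at *
  nlinarith [sq_nonneg ((p : ℤ) - q)]

/-! ### Weights and qualifying sets for one value of `e` -/

section Main

variable {F : Type*} [Field F] {S : Fin 2 → Finset F} {s v j : ℕ}

theorem le_supportSize_of_isConsiderate (hS : ∀ t, (S t).card = s)
    (hcons : IsConsiderate (fun _ : Fin 2 => s) (fun _ => v) fun _ => j) {p q h e : ℕ}
    (he1 : 1 ≤ e) (he : e + h = p * q) (hle : e ≤ (j - v + 1) ^ 2)
    (hmin : ∀ p' q', e ≤ p' * q' → p + q ≤ p' + q') {D : Submodule F (CartesianPoint S → F)}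
    (hD : D ≤ monomialCartesianCode S (considerateL1 fun _ => j))
    (hD₂ : D ⊓ monomialCartesianCode S (considerateL2 (fun _ => v) fun _ => j) = ⊥)
    (hDe : Module.finrank F D = e) :
    (s - j - 1 + p) * (s - j - 1 + q) - h ≤ supportSize D := by
  have hj : j < s := (hcons.1 0).2
  have hv : v < j := (hcons.1 0).1
  obtain ⟨K, hK, hKe, hKD⟩ := exists_subset_considerateDiamond hS hj hD hD₂ hDe
  obtain ⟨K', hK', hKe', hKmin⟩ := hcons.2 e he1 (by
    have : j + 1 - v = j - v + 1 := by omega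
    simpa [considerateBox, this] using hle)
  obtain ⟨p', q', h1, h2⟩ := exists_le_shadowSize hK' (Finset.card_pos.1 (by omega)) hj
  refine le_trans ?_ ((h2.trans (hKmin K hK hKe)).trans (shadowSize_le_supportSize hS hKD))
  rw [hKe'] at h1 ⊢
  have h3 := Nat.mul_le_mul_left (s - j - 1) (hmin p' q' h1)
  rw [Nat.sub_le_iff_le_add]
  -- `(m + p)(m + q) = m² + m(p + q) + e + h` with `m = s - j - 1`.
  nlinarith

theorem length_eq (hS : ∀ t, (S t).card = s) (hv : v < j) (hj : j < s) {k ℓ : ℕ}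
    (scheme : CosetScheme (monomialCartesianCode S (considerateL2 (fun _ => v) fun _ => j))
      (monomialCartesianCode S (considerateL1 fun _ => j)) k ℓ) : ℓ = (j - v + 1) ^ 2 := by
  have h1 := scheme.finrank_mask_payload
  have h2 := scheme.finrank_mask
  rw [finrank_monomialCartesianCode hS (considerateL1_lt hj)] at h1
  have hsub : considerateBox (fun _ : Fin 2 => v) (fun _ => j) ⊆ considerateL1 fun _ => j :=
    Fintype.piFinset_subset _ _ fun _ => Finset.Icc_subset_Icc_left (Nat.zero_le _)
  rw [finrank_monomialCartesianCode hS (considerateL2_lt hj), considerateL2] at h2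
  have h3 := Finset.card_sdiff_add_card_eq_card hsub
  have h4 : (considerateBox (fun _ : Fin 2 => v) fun _ => j).card = (j - v + 1) ^ 2 := by
    have : j + 1 - v = j - v + 1 := by omega
    simp [considerateBox, this]
  omega

theorem ncard_univ_pi_fin_two {α : Fin 2 → Type*} [∀ t, Finite (α t)] (T : (t : Fin 2) → Set (α t)) :
    (Set.univ.pi T).ncard = (T 0).ncard * (T 1).ncard := by
  rw [Set.ncard_def, Set.encard_pi_eq_prod_encard, Fin.prod_univ_two, ENat.toNat_mul]
  rfl

theorem exists_submodule_of_rectangle_sdiff (hS : ∀ t, (S t).card = s) {p q h e : ℕ} (hj : j < s)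
    (hp : v + p ≤ j + 1) (hq : v + q ≤ j + 1) (he : e + h = p * q) (T : (t : Fin 2) → Set (S t))
    (hT₀ : (T 0).ncard + (j + 1) = s + p) (hT₁ : (T 1).ncard + (j + 1) = s + q)
    {U : Set (CartesianPoint S)} (hU : U.ncard ≤ h) :
    ∃ D ≤ monomialCartesianCode S (considerateL1 fun _ => j),
      D ⊓ monomialCartesianCode S (considerateL2 (fun _ => v) fun _ => j) = ⊥ ∧
      Module.finrank F D = e ∧ D ≤ vanishingOn F (Set.univ.pi T \ U)ᶜ := by
  obtain ⟨G, h1, h2, h3, h4⟩ := exists_submodule_of_rectangle (v := v) hS hj hp hq T hT₀ hT₁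
  have h5 := le_finrank_inf_vanishingOn G U
  obtain ⟨D, h6, h7⟩ := exists_submodule_finrank_eq (G ⊓ vanishingOn F U) (e := e) (by omega)
  have hDG : D ≤ G := h6.trans inf_le_left
  refine ⟨D, hDG.trans h1, eq_bot_iff.2 ((inf_le_inf_right _ hDG).trans h2.le), h7, ?_⟩
  intro f hf x hx
  by_cases hxU : x ∈ U
  · exact (h6 hf).2 x hxU
  · exact h4 (hDG hf) x fun hxT => hx ⟨hxT, hxU⟩

/-- Common core of the two situations: `(p, q)` is `(z, z - 1)` in the first and `(z, z)` in the
second. -/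
theorem weights_of_rectangle (hS : ∀ t, (S t).card = s)
    (hcons : IsConsiderate (fun _ : Fin 2 => s) (fun _ => v) fun _ => j) {C₁ C₂} {k ℓ : ℕ}
    (hC₁ : C₁ = monomialCartesianCode S (considerateL1 fun _ => j))
    (hC₂ : C₂ = monomialCartesianCode S (considerateL2 (fun _ => v) fun _ => j))
    (scheme : CosetScheme C₂ C₁ k ℓ) {p q h e : ℕ} (he1 : 1 ≤ e) (heℓ : e ≤ ℓ)
    (he : e + h = p * q) (hp : v + p ≤ j + 1) (hq : v + q ≤ j + 1)
    (hmin : ∀ p' q', e ≤ p' * q' → p + q ≤ p' + q') :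
    relGenHammingWeight C₁ C₂ e + h = (s - j - 1 + p) * (s - j - 1 + q) ∧
    scheme.reconstructionNumber (ℓ - e + 1) + (s - j - 1 + p) * (s - j - 1 + q) =
      s ^ 2 + h + 1 ∧
    ∀ T : (t : Fin 2) → Set (S t),
      (((T 0).ncard = s - j - 1 + p ∧ (T 1).ncard = s - j - 1 + q) ∨
        ((T 0).ncard = s - j - 1 + q ∧ (T 1).ncard = s - j - 1 + p)) →
      ∀ U ⊆ Set.univ.pi T, U.ncard ≤ h →
        scheme.ObtainsAtMost (Set.univ.pi T \ U)ᶜ (ℓ - e) ∧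
        (scheme.MaximumNonQualifying (ℓ - e + 1) (Set.univ.pi T \ U)ᶜ ↔ U.ncard = h) := by
  subst hC₁ hC₂
  have hv : v < j := (hcons.1 0).1
  have hj : j < s := (hcons.1 0).2
  have hℓ := length_eq hS hv hj scheme
  have low := fun D hD hD₂ hDe =>
    le_supportSize_of_isConsiderate hS hcons he1 he (hℓ ▸ heℓ) hmin (D := D) hD hD₂ hDe
  have hrect : ∀ T : (t : Fin 2) → Set (S t),
      (((T 0).ncard = s - j - 1 + p ∧ (T 1).ncard = s - j - 1 + q) ∨
        ((T 0).ncard = s - j - 1 + q ∧ (T 1).ncard = s - j - 1 + p)) →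
      (Set.univ.pi T).ncard = (s - j - 1 + p) * (s - j - 1 + q) ∧
      ∀ U : Set (CartesianPoint S), U.ncard ≤ h →
        ∃ D ≤ monomialCartesianCode S (considerateL1 fun _ => j),
          D ⊓ monomialCartesianCode S (considerateL2 (fun _ => v) fun _ => j) = ⊥ ∧
          Module.finrank F D = e ∧ D ≤ vanishingOn F (Set.univ.pi T \ U)ᶜ := by
    intro T hT
    rw [ncard_univ_pi_fin_two]
    rcases hT with ⟨h0, h1⟩ | ⟨h0, h1⟩
    · exact ⟨by rw [h0, h1], fun U hU => exists_submodule_of_rectangle_sdiff hS hj hp hq he T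
        (by omega) (by omega) hU⟩
    · exact ⟨by rw [h0, h1, mul_comm], fun U hU => exists_submodule_of_rectangle_sdiff hS hj hq hp
        (he.trans (mul_comm _ _)) T (by omega) (by omega) hU⟩
  have hh : h ≤ (s - j - 1 + p) * (s - j - 1 + q) := by
    have : p * q ≤ (s - j - 1 + p) * (s - j - 1 + q) :=
      Nat.mul_le_mul (Nat.le_add_left _ _) (Nat.le_add_left _ _)
    omega
  have hcard : ∀ t, Nat.card (S t) = s := fun t => by simp [hS]
  have up : ∃ D ≤ monomialCartesianCode S (considerateL1 fun _ => j),
      D ⊓ monomialCartesianCode S (considerateL2 (fun _ => v) fun _ => j) = ⊥ ∧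
      Module.finrank F D = e ∧ supportSize D ≤ (s - j - 1 + p) * (s - j - 1 + q) - h := by
    obtain ⟨T₀, -, hT₀⟩ := Set.exists_subset_card_eq (s := (Set.univ : Set (S 0)))
      (n := s - j - 1 + p) (by rw [Set.ncard_univ, hcard]; omega)
    obtain ⟨T₁, -, hT₁⟩ := Set.exists_subset_card_eq (s := (Set.univ : Set (S 1)))
      (n := s - j - 1 + q) (by rw [Set.ncard_univ, hcard]; omega)
    let T : (t : Fin 2) → Set (S t) := Fin.cons T₀ (Fin.cons T₁ finZeroElim)
    obtain ⟨hT, hTD⟩ := hrect T (Or.inl ⟨hT₀, hT₁⟩)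
    obtain ⟨U, hU, hUh⟩ := Set.exists_subset_card_eq (hT ▸ hh)
    obtain ⟨D, h1, h2, h3, h4⟩ := hTD U hUh.le
    refine ⟨D, h1, h2, h3, ?_⟩
    rw [le_vanishingOn_iff, compl_compl] at h4
    refine (Set.ncard_le_ncard h4).trans ?_
    rw [Set.ncard_sdiff hU, hT, hUh]
  refine ⟨?_, ?_, ?_⟩
  · rw [relGenHammingWeight_eq low up]
    omega
  · have := scheme.reconstructionNumber_eq heℓ low up
    rw [card_cartesianPoint hS] at this
    omega
  · intro T hT U hU hUh
    obtain ⟨hTc, hTD⟩ := hrect T hT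
    obtain ⟨D, h1, h2, h3, h4⟩ := hTD U hUh
    have h5 := scheme.finrank_le_finrank_hiddenSecrets h1 h2 h4
    refine ⟨(scheme.obtainsAtMost_iff _ _).2 (by omega), ?_⟩
    rw [scheme.maximumNonQualifying_iff heℓ low up ((scheme.nonQualifying_iff heℓ _).2 (h3 ▸ h5)),
      compl_compl, Set.ncard_sdiff hU, hTc]
    omega

end Main

/-! ### The two forms of `e` -/

theorem isPronicForm_iff {w e z h : ℕ} : IsPronicForm (w ^ 2) e z h ↔
    e + h = z * (z - 1) ∧ 2 ≤ z ∧ z ≤ w ∧ h + 1 < z := by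
  unfold IsPronicForm
  rw [Nat.cast_pow, Real.sqrt_sq (Nat.cast_nonneg w), Nat.cast_le]
  constructor
  · rintro ⟨h1, h2, h3, h4⟩
    refine ⟨?_, h3, h2, by omega⟩
    zify [show 1 ≤ z by omega]
    omega
  · rintro ⟨h1, h2, h3, h4⟩
    refine ⟨?_, h3, h2, by omega⟩
    zify [show 1 ≤ z by omega] at h1
    omega

theorem isSquareForm_iff {w e z h : ℕ} : IsSquareForm (w ^ 2) e z h ↔
    e + h = z * z ∧ 1 ≤ z ∧ z ≤ w ∧ h < z := by
  unfold IsSquareForm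
  rw [Nat.cast_pow, Real.sqrt_sq (Nat.cast_nonneg w), Nat.cast_le]
  constructor
  · rintro ⟨h1, h2, h3, h4⟩
    refine ⟨?_, h3, h2, by omega⟩
    zify
    rw [sq] at h1
    omega
  · rintro ⟨h1, h2, h3, h4⟩
    refine ⟨?_, h3, h2, by omega⟩
    zify at h1
    rw [sq]
    omega

theorem IsPronicForm.bounds {w e z h : ℕ} (hf : IsPronicForm (w ^ 2) e z h) :
    (z - 1) ^ 2 < e ∧ e ≤ z * (z - 1) := by
  obtain ⟨h1, h2, h3, h4⟩ := isPronicForm_iff.1 hf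
  obtain ⟨y, rfl⟩ : ∃ y, z = y + 1 := ⟨z - 1, by omega⟩
  rw [Nat.add_sub_cancel] at *
  constructor <;> nlinarith

theorem IsSquareForm.bounds {w e z h : ℕ} (hf : IsSquareForm (w ^ 2) e z h) :
    z * (z - 1) < e ∧ e ≤ z * z := by
  obtain ⟨h1, h2, h3, h4⟩ := isSquareForm_iff.1 hf
  obtain ⟨y, rfl⟩ : ∃ y, z = y + 1 := ⟨z - 1, by omega⟩
  rw [Nat.add_sub_cancel]
  constructor <;> nlinarith

/-- Both forms determine `z` as the least number whose square is at least `e`. -/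
theorem eq_of_pred_sq_lt {e z z' : ℕ} (h1 : (z - 1) ^ 2 < e) (h2 : e ≤ z * z)
    (h1' : (z' - 1) ^ 2 < e) (h2' : e ≤ z' * z') : z = z' := by
  by_contra hne
  rcases Nat.lt_or_gt_of_ne hne with h | h
  · have := Nat.pow_le_pow_left (show z ≤ z' - 1 by omega) 2
    rw [sq z] at this
    omega
  · have := Nat.pow_le_pow_left (show z' ≤ z - 1 by omega) 2
    rw [sq z'] at this
    omega

/-- The intervals `((z - 1)², z(z - 1)]` and `(z(z - 1), z²]` partition the positive integers. The
interval containing `e` decides the form and `z`, and then `h` is determined. -/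
theorem existsUnique_form {w e : ℕ} (he1 : 1 ≤ e) (he : e ≤ w ^ 2) :
    ((∃! p : ℕ × ℕ, IsPronicForm (w ^ 2) e p.1 p.2) ∧ ¬ ∃ z h, IsSquareForm (w ^ 2) e z h) ∨
      ((∃! p : ℕ × ℕ, IsSquareForm (w ^ 2) e p.1 p.2) ∧ ¬ ∃ z h, IsPronicForm (w ^ 2) e z h) := by
  have hpro : ∀ {z h}, IsPronicForm (w ^ 2) e z h → (z - 1) ^ 2 < e ∧ e ≤ z * z := fun {z h} hf =>
    ⟨hf.bounds.1, hf.bounds.2.trans (Nat.mul_le_mul_left _ (Nat.sub_le _ _))⟩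
  have hsqr : ∀ {z h}, IsSquareForm (w ^ 2) e z h → (z - 1) ^ 2 < e ∧ e ≤ z * z := fun {z h} hf =>
    ⟨lt_of_le_of_lt (by rw [sq]; exact Nat.mul_le_mul_right _ (Nat.sub_le _ _)) hf.bounds.1,
      hf.bounds.2⟩
  have hboth : ∀ {z h z' h'}, IsPronicForm (w ^ 2) e z h → IsSquareForm (w ^ 2) e z' h' →
      False := by
    intro z h z' h' hf hf'
    obtain rfl := eq_of_pred_sq_lt (hpro hf).1 (hpro hf).2 (hsqr hf').1 (hsqr hf').2
    exact absurd hf'.bounds.1 (not_lt.2 hf.bounds.2)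
  obtain ⟨y, hy⟩ : ∃ y, y ^ 2 < e ∧ e ≤ (y + 1) * (y + 1) := by
    have hex : ∃ z, e ≤ z * z := ⟨w, by rwa [← sq]⟩
    have hpos : Nat.find hex ≠ 0 := by
      intro h0
      have := Nat.find_spec hex
      rw [h0] at this
      omega
    refine ⟨Nat.find hex - 1, ?_, ?_⟩
    · rw [sq]
      exact not_le.1 (Nat.find_min hex (Nat.sub_one_lt hpos))
    · rw [Nat.sub_one_add_one hpos]
      exact Nat.find_spec hex
  have hyw : y < w := lt_of_pow_lt_pow_left₀ 2 (Nat.zero_le _) (hy.1.trans_le he)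
  rcases le_or_gt e ((y + 1) * y) with h | h
  · left
    have hf : IsPronicForm (w ^ 2) e (y + 1) ((y + 1) * y - e) := by
      refine isPronicForm_iff.2 ⟨by rw [Nat.add_sub_cancel]; omega, ?_, hyw, ?_⟩
      · rcases y with _ | y <;> omega
      · have h1 := hy.1
        rw [add_mul, one_mul, ← sq] at *
        omega
    refine ⟨⟨(y + 1, _), hf, ?_⟩, fun ⟨z, h, hf'⟩ => hboth hf hf'⟩
    rintro ⟨z, h'⟩ hf'
    obtain rfl : z = y + 1 :=
      eq_of_pred_sq_lt (hpro hf').1 (hpro hf').2 (hpro hf).1 (hpro hf).2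
    have h1 := (isPronicForm_iff.1 hf').1
    have h2 := (isPronicForm_iff.1 hf).1
    exact Prod.ext rfl (by dsimp only at *; omega)
  · right
    have hf : IsSquareForm (w ^ 2) e (y + 1) ((y + 1) * (y + 1) - e) := by
      refine isSquareForm_iff.2 ⟨by omega, by omega, hyw, ?_⟩
      rw [mul_add, mul_one] at *
      omega
    refine ⟨⟨(y + 1, _), hf, ?_⟩, fun ⟨z, h, hf'⟩ => hboth hf' hf⟩
    rintro ⟨z, h'⟩ hf'
    obtain rfl : z = y + 1 :=
      eq_of_pred_sq_lt (hsqr hf').1 (hsqr hf').2 (hsqr hf).1 (hsqr hf).2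
    have h1 := (isSquareForm_iff.1 hf').1
    have h2 := (isSquareForm_iff.1 hf).1
    exact Prod.ext rfl (by dsimp only at *; omega)

theorem mainTheorem3 {F : Type*} [Field F] [Finite F] (S : Fin 2 → Finset F) (s v j k ℓ : ℕ)
    (hS : ∀ t, (S t).card = s)
    (hcons : IsConsiderate (fun _ : Fin 2 => s) (fun _ => v) (fun _ => j))
    (C₁ C₂ : Submodule F (CartesianPoint S → F))
    (hC₁ : C₁ = monomialCartesianCode S (considerateL1 fun _ => j))
    (hC₂ : C₂ = monomialCartesianCode S (considerateL2 (fun _ => v) fun _ => j))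
    (scheme : CosetScheme C₂ C₁ k ℓ) :
    Nat.card (CartesianPoint S) = s ^ 2 ∧
    (ℓ : ℤ) = (j - v + 1) ^ 2 ∧
    ∀ e : ℕ, 1 ≤ e → e ≤ ℓ →
      (((∃! p : ℕ × ℕ, IsPronicForm ℓ e p.1 p.2) ∧ ¬ ∃ z h, IsSquareForm ℓ e z h) ∨
        ((∃! p : ℕ × ℕ, IsSquareForm ℓ e p.1 p.2) ∧ ¬ ∃ z h, IsPronicForm ℓ e z h)) ∧
      (∀ z h : ℕ, IsPronicForm ℓ e z h →
        (relGenHammingWeight C₁ C₂ e : ℤ) = (s - j - 1 + z) * (s - j - 2 + z) - h ∧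
        (scheme.reconstructionNumber (ℓ - e + 1) : ℤ) =
          s ^ 2 - (s - j - 1 + z) * (s - j - 2 + z) + h + 1 ∧
        ∀ T : (t : Fin 2) → Set (S t),
          (((T 0).ncard : ℤ) = s - j - 1 + z ∧ ((T 1).ncard : ℤ) = s - j - 2 + z ∨
            ((T 0).ncard : ℤ) = s - j - 2 + z ∧ ((T 1).ncard : ℤ) = s - j - 1 + z) →
          ∀ U ⊆ Set.univ.pi T, U.ncard ≤ h →
            scheme.ObtainsAtMost (Set.univ.pi T \ U)ᶜ (ℓ - e) ∧
            (scheme.MaximumNonQualifying (ℓ - e + 1) (Set.univ.pi T \ U)ᶜ ↔ U.ncard = h)) ∧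
      (∀ z h : ℕ, IsSquareForm ℓ e z h →
        (relGenHammingWeight C₁ C₂ e : ℤ) = (s - j - 1 + z) ^ 2 - h ∧
        (scheme.reconstructionNumber (ℓ - e + 1) : ℤ) = s ^ 2 - (s - j - 1 + z) ^ 2 + h + 1 ∧
        ∀ T : (t : Fin 2) → Set (S t),
          ((T 0).ncard : ℤ) = s - j - 1 + z → ((T 1).ncard : ℤ) = s - j - 1 + z →
          ∀ U ⊆ Set.univ.pi T, U.ncard ≤ h →
            scheme.ObtainsAtMost (Set.univ.pi T \ U)ᶜ (ℓ - e) ∧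
            (scheme.MaximumNonQualifying (ℓ - e + 1) (Set.univ.pi T \ U)ᶜ ↔ U.ncard = h)) := by
  have hv : v < j := (hcons.1 0).1
  have hj : j < s := (hcons.1 0).2
  have hℓ : ℓ = (j - v + 1) ^ 2 := by
    subst hC₁ hC₂
    exact length_eq hS hv hj scheme
  refine ⟨card_cartesianPoint hS, ?_, fun e he1 he => ⟨?_, fun z h hf => ?_, fun z h hf => ?_⟩⟩
  · rw [hℓ]
    push_cast [hv.le]
    rfl
  · rw [hℓ]
    exact existsUnique_form he1 (hℓ ▸ he)
  · rw [hℓ] at hf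
    have hb := hf.bounds
    obtain ⟨h1, h2, h3, h4⟩ := isPronicForm_iff.1 hf
    obtain ⟨hM, hr, hT⟩ := weights_of_rectangle hS hcons hC₁ hC₂ scheme he1 he h1 (by omega)
      (by omega) fun p' q' h' => add_pred_le_add_of_sq_lt h' hb.1
    have c1 : ((s - j - 1 + z : ℕ) : ℤ) = s - j - 1 + z := by omega
    -- The `1` is taken from `z ≥ 2`, since `s - j - 2` may be negative.
    have c2 : ((s - j - 1 + (z - 1) : ℕ) : ℤ) = s - j - 2 + z := by omega
    rw [← c1, ← c2]
    refine ⟨?_, ?_, fun T hT' => hT T ?_⟩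
    · rw [eq_sub_iff_add_eq]
      exact_mod_cast hM
    · have hr' : (scheme.reconstructionNumber (ℓ - e + 1) : ℤ) +
          (s - j - 1 + z : ℕ) * (s - j - 1 + (z - 1) : ℕ) = s ^ 2 + h + 1 := by exact_mod_cast hr
      linarith
    · exact_mod_cast hT'
  · rw [hℓ] at hf
    have hb := hf.bounds
    obtain ⟨h1, h2, h3, h4⟩ := isSquareForm_iff.1 hf
    obtain ⟨hM, hr, hT⟩ := weights_of_rectangle hS hcons hC₁ hC₂ scheme he1 he h1 (by omega)
      (by omega) fun p' q' h' => add_self_le_add_of_mul_pred_lt h' hb.1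
    have c1 : ((s - j - 1 + z : ℕ) : ℤ) = s - j - 1 + z := by omega
    rw [← c1]
    rw [← sq] at hM hr
    refine ⟨?_, ?_, fun T hT₀ hT₁ => hT T (Or.inl ⟨?_, ?_⟩)⟩
    · rw [eq_sub_iff_add_eq]
      exact_mod_cast hM
    · have hr' : (scheme.reconstructionNumber (ℓ - e + 1) : ℤ) +
          (s - j - 1 + z : ℕ) ^ 2 = s ^ 2 + h + 1 := by exact_mod_cast hr
      linarith
    · exact_mod_cast hT₀
    · exact_mod_cast hT₁
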